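/- Write $[k]=\{0,1,\dots,k-1\}$. A partial latin square of order $n$ on $[n]$ is a nonempty set $P\subseteq[n]\times[n]\times[n]$ of triples (row, column, symbol) such that any two triples of $P$ that agree in two coordinates agree in the third; it is a latin square of order $n$ if $|P|=n^2$. Two partial latin squares $P,Q$ on $[n]$ are orthogonal if they have the same non-empty cells (that is, for all $r,c$, some $(r,c,x)\in P$ if and only if some $(r,c,y)\in Q$) and there are no two distinct cells $(r_1,c_1)\neq(r_2,c_2)$ and symbols $x,y$ with $(r_1,c_1,x),(r_2,c_2,x)\in P$ and $(r_1,c_1,y),(r_2,c_2,y)\in Q$. **Theorem 4.2.** Let $P$ and $Q$ be orthogonal partial latin squares of order $n$ on $[n]$, and let $m$ be any positive integer with $n\le 2^m$. Then there are orthogonal latin squares $\mathcal A$ and $\mathcal B$ of order $2^{4m}$ on $[2^{4m}]$ such that $P\subseteq\mathcal A$ and $Q\subseteq\mathcal B$. -/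

import Mathlib

/-- A partial latin square on the finite set `N` (of order `N.card`): a nonempty set of triples
(row, column, symbol) from `N` in which any two coordinates of a triple determine the third. -/
def IsPartialLatinSquare {α : Type*} (N : Finset α) (P : Finset (α × α × α)) : Prop :=
  P.Nonempty ∧
  (∀ r c x, (r, c, x) ∈ P → r ∈ N ∧ c ∈ N ∧ x ∈ N) ∧
  (∀ r c x x', (r, c, x) ∈ P → (r, c, x') ∈ P → x = x') ∧
  (∀ r c c' x, (r, c, x) ∈ P → (r, c', x) ∈ P → c = c') ∧
  (∀ r r' c x, (r, c, x) ∈ P → (r', c, x) ∈ P → r = r')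

/-- A latin square on `N`: a partial latin square on `N` with `|N|²` triples. -/
def IsLatinSquare {α : Type*} (N : Finset α) (L : Finset (α × α × α)) : Prop :=
  IsPartialLatinSquare N L ∧ L.card = N.card ^ 2

/-- Orthogonality of two (partial) latin squares: they have the same non-empty cells, and no two
distinct cells carry equal symbols in `P` as well as equal symbols in `Q`. -/
def AreOrthogonal {α : Type*} (P Q : Finset (α × α × α)) : Prop :=
  (∀ r c, (∃ x, (r, c, x) ∈ P) ↔ (∃ y, (r, c, y) ∈ Q)) ∧
  (∀ r₁ c₁ r₂ c₂ x y, (r₁, c₁) ≠ (r₂, c₂) →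
    (r₁, c₁, x) ∈ P → (r₂, c₂, x) ∈ P → ¬ ((r₁, c₁, y) ∈ Q ∧ (r₂, c₂, y) ∈ Q))

/-! Index the non-empty cells by `k`, with row `r k`, column `c k` and symbols `p k`, `q k`;
orthogonality of `P` and `Q` says that any two of these four functions determine `k`. Only
coincidences matter: it suffices to find an orthogonal pair on a set of size `2 ^ (4 * m)` and cells
in it whose rows, columns and two symbols coincide exactly when `r`, `c`, `p`, `q` do, since
bijections then renumber everything (`IsOrthogonalPair.exists_embedding`).

The engine is `IsOrthogonalPair.exists_lift`. If `B` takes distinct symbols on the chosen cells,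
pass to a product with `Z` and swap `B`-symbols over individual cells of `Z`, so that the new
`B`-symbols coincide exactly when `q` does. The swaps are harmless because they only exchange
symbols `b` carrying the same pair on `Z` (`IsOrthogonalPair.twistedProd`).

Over a field `F` of order `2 ^ m` with `m ≥ 2`, start from a linear pair on `F × F`, where the sum
of `(r k, 0)` and `(0, c k)` separates the cells. One lift corrects the symbols for `p`, a second
those for `q`, giving order `|F| ^ 4`. For `m = 1` the field of two elements has no `a ≠ 0, 1`;
there `p` or `q` is already injective, so a single lift over the field of four elements gives order
`4 ^ 2 = 2 ^ 4`. -/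

/-- Two binary operations on `X` whose multiplication tables are orthogonal latin squares
(for finite `X`). -/
structure IsOrthogonalPair {X : Type*} (A B : X → X → X) : Prop where
  left_fst : ∀ x y y', A x y = A x y' → y = y'
  right_fst : ∀ x x' y, A x y = A x' y → x = x'
  left_snd : ∀ x y y', B x y = B x y' → y = y'
  right_snd : ∀ x x' y, B x y = B x' y → x = x'
  orth : ∀ x y x' y', A x y = A x' y' → B x y = B x' y' → x = x' ∧ y = y'

theorem IsOrthogonalPair.symm {X : Type*} {A B : X → X → X} (h : IsOrthogonalPair A B) :
    IsOrthogonalPair B A :=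
  ⟨h.left_snd, h.right_snd, h.left_fst, h.right_fst,
    fun x y x' y' hB hA => h.orth x y x' y' hA hB⟩

/-! ### Explicit orthogonal pairs over a field -/

/-- The linear pair `x + y`, `x + a y` over a vector space. -/
theorem isOrthogonalPair_linear {F X : Type*} [Field F] [AddCommGroup X] [Module F X]
    {a : F} (ha0 : a ≠ 0) (ha1 : a ≠ 1) :
    IsOrthogonalPair (fun x y : X => x + y) (fun x y : X => x + a • y) where
  left_fst x y y' h := by simpa using h
  right_fst x x' y h := by simpa using h
  left_snd x y y' h := by
    have h1 : a • y = a • y' := by simpa using h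
    exact smul_right_injective X ha0 h1
  right_snd x x' y h := by simpa using h
  orth x y x' y' h1 h2 := by
    have h3 : (a - 1) • y = (a - 1) • y' := by
      rw [sub_smul, sub_smul, one_smul, one_smul]
      calc a • y - y = (x + a • y) - (x + y) := by abel
        _ = (x' + a • y') - (x' + y') := by rw [h1, h2]
        _ = a • y' - y' := by abel
    have h4 : y = y' := smul_right_injective X (sub_ne_zero.2 ha1) h3
    subst h4
    exact ⟨by simpa using h1, rfl⟩

/-- An idempotent operation over a field with an orthogonal mate vanishing on the diagonal. -/
theorem isOrthogonalPair_idempotent {F : Type*} [Field F] {a : F} (ha0 : a ≠ 0) (ha1 : a ≠ 1) :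
    IsOrthogonalPair (fun x y : F => x + a * (y - x)) (fun x y : F => y - x) where
  left_fst x y y' h := by
    have h1 : a * (y - x) = a * (y' - x) := by simpa using h
    simpa using mul_left_cancel₀ ha0 h1
  right_fst x x' y h := by
    have h1 : (1 - a) * x = (1 - a) * x' := by linear_combination h
    exact mul_left_cancel₀ (sub_ne_zero.2 ha1.symm) h1
  left_snd x y y' h := by simpa using h
  right_snd x x' y h := by simpa using h
  orth x y x' y' h1 h2 := by
    have h3 : x = x' := by linear_combination h1 - a * h2
    subst h3
    exact ⟨rfl, by simpa using h2⟩

/-! ### Twisted products and the lift -/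

/-- A product of an orthogonal pair on `X` with orthogonal pairs on `Z` chosen according to the
`B`-symbol, in which the `B`-symbol is moreover permuted depending on the cell of `Z`. -/
theorem IsOrthogonalPair.twistedProd {X Z : Type*} {A B : X → X → X}
    (h : IsOrthogonalPair A B) {α β : X → Z → Z → Z}
    (hZ : ∀ b, IsOrthogonalPair (α b) (β b)) {π : Z → Z → X → X}
    (hπ : ∀ z w, Function.Injective (π z w))
    (hα : ∀ z w b, α (π z w b) z w = α b z w) (hβ : ∀ z w b, β (π z w b) z w = β b z w) :
    IsOrthogonalPair
      (fun s t : X × Z => (A s.1 t.1, α (B s.1 t.1) s.2 t.2))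
      (fun s t : X × Z => (π s.2 t.2 (B s.1 t.1), β (B s.1 t.1) s.2 t.2)) where
  left_fst := by
    rintro ⟨x, z⟩ ⟨y, w⟩ ⟨y', w'⟩ h1
    simp only [Prod.mk.injEq] at h1 ⊢
    obtain ⟨h1, h2⟩ := h1
    obtain rfl := h.left_fst _ _ _ h1
    exact ⟨rfl, (hZ _).left_fst _ _ _ h2⟩
  right_fst := by
    rintro ⟨x, z⟩ ⟨x', z'⟩ ⟨y, w⟩ h1
    simp only [Prod.mk.injEq] at h1 ⊢
    obtain ⟨h1, h2⟩ := h1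
    obtain rfl := h.right_fst _ _ _ h1
    exact ⟨rfl, (hZ _).right_fst _ _ _ h2⟩
  left_snd := by
    rintro ⟨x, z⟩ ⟨y, w⟩ ⟨y', w'⟩ h1
    simp only [Prod.mk.injEq] at h1 ⊢
    obtain ⟨h1, h2⟩ := h1
    -- The pair on `Z` is unchanged when `b` is replaced by `π z w b`, and these replaced symbols
    -- agree by `h1`, so both sides use the same pair.
    rw [← hβ z w, ← hβ z w', h1] at h2
    obtain rfl := (hZ _).left_snd _ _ _ h2
    exact ⟨h.left_snd _ _ _ (hπ _ _ h1), rfl⟩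
  right_snd := by
    rintro ⟨x, z⟩ ⟨x', z'⟩ ⟨y, w⟩ h1
    simp only [Prod.mk.injEq] at h1 ⊢
    obtain ⟨h1, h2⟩ := h1
    rw [← hβ z w, ← hβ z' w, h1] at h2
    obtain rfl := (hZ _).right_snd _ _ _ h2
    exact ⟨h.right_snd _ _ _ (hπ _ _ h1), rfl⟩
  orth := by
    rintro ⟨x, z⟩ ⟨y, w⟩ ⟨x', z'⟩ ⟨y', w'⟩ h1 h2
    simp only [Prod.mk.injEq] at h1 h2 ⊢
    obtain ⟨h1, h3⟩ := h1
    obtain ⟨h2, h4⟩ := h2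
    rw [← hα z w, ← hα z' w', h2] at h3
    rw [← hβ z w, ← hβ z' w', h2] at h4
    obtain ⟨rfl, rfl⟩ := (hZ _).orth _ _ _ _ h3 h4
    obtain ⟨rfl, rfl⟩ := h.orth _ _ _ _ h1 (hπ _ _ h2)
    exact ⟨⟨rfl, rfl⟩, rfl, rfl⟩

/-- Relabelling columns and `A`-symbols preserves orthogonality. -/
theorem IsOrthogonalPair.relabel {Z : Type*} {α β : Z → Z → Z} (h : IsOrthogonalPair α β)
    (e s : Equiv.Perm Z) :
    IsOrthogonalPair (fun z w => s (α z (e.symm w))) (fun z w => β z (e.symm w)) where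
  left_fst x y y' h1 := e.symm.injective (h.left_fst _ _ _ (s.injective h1))
  right_fst x x' y h1 := h.right_fst _ _ _ (s.injective h1)
  left_snd x y y' h1 := e.symm.injective (h.left_snd _ _ _ h1)
  right_snd x x' y h1 := h.right_snd _ _ _ h1
  orth x y x' y' h1 h2 := by
    obtain ⟨h3, h4⟩ := h.orth _ _ _ _ (s.injective h1) h2
    exact ⟨h3, e.symm.injective h4⟩

/-- Two families with the same coincidences, in types of the same finite size, are matched by a
bijection. -/
theorem exists_equiv_apply_eq {ι X Y : Type*} [Finite ι] [Fintype X] [Fintype Y]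
    (hcard : Fintype.card X = Fintype.card Y) (f : ι → X) (g : ι → Y)
    (hfg : ∀ k k', f k = f k' ↔ g k = g k') : ∃ e : X ≃ Y, ∀ k, e (f k) = g k := by
  classical
  have := Fintype.ofFinite ι
  -- The default off the range of `f` is irrelevant; the cardinality bijection merely supplies some
  -- value.
  let F : X → Y := Function.extend f g (Fintype.equivOfCardEq hcard)
  have hF : ∀ k, F (f k) = g k := fun k =>
    Function.FactorsThrough.extend_apply (fun a b hab => (hfg a b).1 hab) _ k
  obtain ⟨e, he⟩ := Finset.exists_equiv_extend_of_card_eq (α := X) (t := (Finset.univ : Finset Y))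
    (by simpa using hcard) (s := Finset.univ.image f) (f := F) (by simp) (by
      intro a ha b hb hab
      simp only [Finset.coe_image, Finset.coe_univ, Set.image_univ, Set.mem_range] at ha hb
      obtain ⟨k, rfl⟩ := ha
      obtain ⟨k', rfl⟩ := hb
      rw [hF, hF] at hab
      exact (hfg k k').2 hab)
  refine ⟨e.trans (Equiv.subtypeUnivEquiv (fun y => Finset.mem_univ y)), fun k => ?_⟩
  have := he (f k) (by simp)
  simpa [hF] using this

/-- A choice of representatives of the fibres of a map. -/
theorem exists_fiber_representative {ι J : Type*} (q : ι → J) :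
    ∃ rep : ι → ι, (∀ k, q (rep k) = q k) ∧ ∀ k k', rep k = rep k' ↔ q k = q k' := by
  have h : ∀ k, q (Set.rangeSplitting q (Set.rangeFactorization q k)) = q k := fun k =>
    Set.apply_rangeSplitting q _
  refine ⟨fun k => Set.rangeSplitting q (Set.rangeFactorization q k), h, fun k k' => ⟨?_, ?_⟩⟩
  · intro hk
    rw [← h k, ← h k']
    exact congrArg q hk
  · intro hk
    have : Set.rangeFactorization q k = Set.rangeFactorization q k' := Subtype.ext hk
    simp only [this]

/-- Cells on which `B` takes distinct symbols can be lifted to the product with `Z` in such a way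
that the new `B`-symbols depend exactly on a prescribed label `q`. -/
theorem IsOrthogonalPair.exists_lift {X Z ι J : Type*} [Finite Z] [Finite ι]
    {A B : X → X → X} (h : IsOrthogonalPair A B)
    {α β : Z → Z → Z} (hZ : IsOrthogonalPair α β) {z₀ : Z} (hα : ∀ z, α z z = z)
    (hβ : ∀ z, β z z = z₀) (r c : ι → X) (ρ γ σ : ι → Z) (q : ι → J)
    (hu : Function.Injective fun k => B (r k) (c k))
    (hργ : ∀ k k', ρ k = ρ k' → γ k = γ k' → k = k')
    (hρ : ∀ k k', q k = q k' → ρ k = ρ k' → k = k')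
    (hγ : ∀ k k', q k = q k' → γ k = γ k' → k = k')
    (hσ : ∀ k k', q k = q k' → σ k = σ k' → k = k') :
    ∃ A' B' : X × Z → X × Z → X × Z, IsOrthogonalPair A' B' ∧
      (∀ k, A' (r k, ρ k) (c k, γ k) = (A (r k) (c k), σ k)) ∧
      ∀ k k', B' (r k, ρ k) (c k, γ k) = B' (r k', ρ k') (c k', γ k') ↔ q k = q k' := by
  classical
  have := Fintype.ofFinite Z
  obtain ⟨rep, hrep, hrep'⟩ := exists_fiber_representative q
  -- On one class of `q` both `ρ` and `γ` are injective, so `ρ k ↦ γ k` extends to a permutation;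
  -- likewise `ρ k ↦ σ k` below.
  have hE : ∀ j, ∃ e : Equiv.Perm Z, ∀ k, q k = j → e (ρ k) = γ k := by
    intro j
    obtain ⟨e, he⟩ := exists_equiv_apply_eq (ι := {k // q k = j}) (X := Z) (Y := Z) rfl
      (fun k => ρ k) (fun k => γ k) (fun k k' =>
        ⟨fun hk => by rw [hρ k k' (k.2.trans k'.2.symm) hk],
          fun hk => by rw [hγ k k' (k.2.trans k'.2.symm) hk]⟩)
    exact ⟨e, fun k hk => he ⟨k, hk⟩⟩
  have hS : ∀ j, ∃ e : Equiv.Perm Z, ∀ k, q k = j → e (ρ k) = σ k := by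
    intro j
    obtain ⟨e, he⟩ := exists_equiv_apply_eq (ι := {k // q k = j}) (X := Z) (Y := Z) rfl
      (fun k => ρ k) (fun k => σ k) (fun k k' =>
        ⟨fun hk => by rw [hρ k k' (k.2.trans k'.2.symm) hk],
          fun hk => by rw [hσ k k' (k.2.trans k'.2.symm) hk]⟩)
    exact ⟨e, fun k hk => he ⟨k, hk⟩⟩
  choose E hE using hE
  choose S hS using hS
  set u : ι → X := fun k => B (r k) (c k) with hu_def
  -- As `u` is injective, the `B`-symbol of a chosen cell determines its label, so the relabellings
  -- may depend on that symbol; other symbols get the identity.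
  let E' : X → Equiv.Perm Z := Function.extend u (fun k => E (q k)) 1
  let S' : X → Equiv.Perm Z := Function.extend u (fun k => S (q k)) 1
  have hE' : ∀ k, E' (u k) = E (q k) := fun k => hu.extend_apply _ _ k
  have hS' : ∀ k, S' (u k) = S (q k) := fun k => hu.extend_apply _ _ k
  -- By `hργ` a cell of `Z` comes from at most one `k`. There `u k` is swapped with the symbol
  -- representing its `q`-class, which gives the whole class a common symbol.
  let π : Z → Z → X → X := fun z w =>
    if hk : ∃ k, ρ k = z ∧ γ k = w then Equiv.swap (u hk.choose) (u (rep hk.choose)) else id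
  have hπk : ∀ k, π (ρ k) (γ k) = Equiv.swap (u k) (u (rep k)) := by
    intro k
    have hk : ∃ k', ρ k' = ρ k ∧ γ k' = γ k := ⟨k, rfl, rfl⟩
    have : hk.choose = k := hργ _ _ hk.choose_spec.1 hk.choose_spec.2
    simp only [π, dif_pos hk, this]
  have hcases : ∀ z w, (∃ k, ρ k = z ∧ γ k = w) ∨ π z w = id := by
    intro z w
    by_cases hk : ∃ k, ρ k = z ∧ γ k = w
    · exact Or.inl hk
    · exact Or.inr (by simp only [π, dif_neg hk])
  -- The swapped symbols `u k` and `u (rep k)` carry the same label, hence the same relabellings.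
  have hq : ∀ z w b, E' (π z w b) = E' b ∧ S' (π z w b) = S' b := by
    intro z w b
    rcases hcases z w with ⟨k, rfl, rfl⟩ | hid
    · rw [hπk, Equiv.swap_apply_def]
      split_ifs with h1 h2
      · rw [h1, hE', hE', hS', hS', hrep]; exact ⟨rfl, rfl⟩
      · rw [h2, hE', hE', hS', hS', hrep]; exact ⟨rfl, rfl⟩
      · exact ⟨rfl, rfl⟩
    · rw [hid]; exact ⟨rfl, rfl⟩
  have hsymm : ∀ k, (E (q k)).symm (γ k) = ρ k := fun k => by
    rw [Equiv.symm_apply_eq, hE _ k rfl]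
  refine ⟨_, _, h.twistedProd (fun b => hZ.relabel (E' b) (S' b)) (π := π) ?_ ?_ ?_, ?_, ?_⟩
  · intro z w
    rcases hcases z w with ⟨k, rfl, rfl⟩ | hid
    · rw [hπk]; exact Equiv.injective _
    · rw [hid]; exact Function.injective_id
  · intro z w b
    simp only [(hq z w b).1, (hq z w b).2]
  · intro z w b
    simp only [(hq z w b).1]
  · intro k
    have hEk : E' (B (r k) (c k)) = E (q k) := hE' k
    have hSk : S' (B (r k) (c k)) = S (q k) := hS' k
    simp only [hEk, hSk, hsymm, hα, hS _ k rfl]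
  -- Undoing `E` moves every chosen cell to the diagonal of `Z`, where `β` is constantly `z₀`.
  · have hB : ∀ k, (π (ρ k) (γ k) (B (r k) (c k)), β (ρ k) ((E' (B (r k) (c k))).symm (γ k))) =
        (u (rep k), z₀) := by
      intro k
      have hEk : E' (B (r k) (c k)) = E (q k) := hE' k
      rw [hEk, hsymm, hβ, hπk]
      exact congrArg (·, z₀) (Equiv.swap_apply_left _ _)
    intro k k'
    simp only [hB, Prod.mk.injEq, and_true]
    exact hu.eq_iff.trans (hrep' k k')

/-! ### Numbering rows, columns and symbols -/

/-- The latin square over `ℕ` obtained by numbering rows, columns and symbols. -/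
theorem isLatinSquare_image {X : Type*} [Fintype X] {M : ℕ} (A : X → X → X)
    (hl : ∀ x y y', A x y = A x y' → y = y') (hr : ∀ x x' y, A x y = A x' y → x = x')
    (hM : 0 < M) (eR eC eA : X ≃ Fin M) :
    IsLatinSquare (Finset.range M) (Finset.univ.image fun t : X × X =>
      ((eR t.1 : ℕ), (eC t.2 : ℕ), (eA (A t.1 t.2) : ℕ))) := by
  have hi : ∀ {e : X ≃ Fin M} {x y : X}, (e x : ℕ) = e y → x = y := fun hxy =>
    Equiv.injective _ (Fin.ext hxy)
  refine ⟨⟨?_, ?_, ?_, ?_, ?_⟩, ?_⟩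
  · have : Nonempty X := ⟨eR.symm ⟨0, hM⟩⟩
    exact Finset.univ_nonempty.image _
  · intro r c x hx
    simp only [Finset.mem_image, Finset.mem_univ, true_and, Prod.mk.injEq] at hx
    obtain ⟨t, rfl, rfl, rfl⟩ := hx
    simp
  · intro r c x x' h1 h2
    simp only [Finset.mem_image, Finset.mem_univ, true_and, Prod.mk.injEq] at h1 h2
    obtain ⟨⟨a, b⟩, rfl, rfl, rfl⟩ := h1
    obtain ⟨⟨a', b'⟩, h3, h4, rfl⟩ := h2
    obtain rfl := hi h3
    obtain rfl := hi h4
    rfl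
  · intro r c x x' h1 h2
    simp only [Finset.mem_image, Finset.mem_univ, true_and, Prod.mk.injEq] at h1 h2
    obtain ⟨⟨a, b⟩, rfl, rfl, rfl⟩ := h1
    obtain ⟨⟨a', b'⟩, h3, rfl, h4⟩ := h2
    obtain rfl := hi h3
    rw [hl _ _ _ (hi h4)]
  · intro r c x x' h1 h2
    simp only [Finset.mem_image, Finset.mem_univ, true_and, Prod.mk.injEq] at h1 h2
    obtain ⟨⟨a, b⟩, rfl, rfl, rfl⟩ := h1
    obtain ⟨⟨a', b'⟩, rfl, h3, h4⟩ := h2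
    obtain rfl := hi h3
    rw [hr _ _ _ (hi h4)]
  · rw [Finset.card_image_of_injective]
    · simp [Fintype.card_congr eR, sq]
    · rintro ⟨a, b⟩ ⟨a', b'⟩ hab
      simp only [Prod.mk.injEq] at hab
      rw [hi hab.1, hi hab.2.1]

/-- An orthogonal pair containing a copy of `P` and `Q`, indexed by the cells, can be renumbered
to contain `P` and `Q`. -/
theorem IsOrthogonalPair.exists_embedding {X ι : Type*} [Fintype X] [Finite ι] {M : ℕ}
    (hM : 0 < M) (hX : Fintype.card X = M) {A B : X → X → X} (h : IsOrthogonalPair A B)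
    (R C : ι → X) (r c p q : ι → Fin M)
    (hR : ∀ k k', R k = R k' ↔ r k = r k') (hC : ∀ k k', C k = C k' ↔ c k = c k')
    (hA : ∀ k k', A (R k) (C k) = A (R k') (C k') ↔ p k = p k')
    (hB : ∀ k k', B (R k) (C k) = B (R k') (C k') ↔ q k = q k') :
    ∃ A' B' : Finset (ℕ × ℕ × ℕ),
      IsLatinSquare (Finset.range M) A' ∧ IsLatinSquare (Finset.range M) B' ∧
      AreOrthogonal A' B' ∧ (∀ k, ((r k : ℕ), (c k : ℕ), (p k : ℕ)) ∈ A') ∧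
      ∀ k, ((r k : ℕ), (c k : ℕ), (q k : ℕ)) ∈ B' := by
  have hcard : Fintype.card X = Fintype.card (Fin M) := by simpa using hX
  obtain ⟨eR, heR⟩ := exists_equiv_apply_eq hcard R r hR
  obtain ⟨eC, heC⟩ := exists_equiv_apply_eq hcard C c hC
  obtain ⟨eA, heA⟩ := exists_equiv_apply_eq hcard _ p hA
  obtain ⟨eB, heB⟩ := exists_equiv_apply_eq hcard _ q hB
  have hi : ∀ {e : X ≃ Fin M} {x y : X}, (e x : ℕ) = e y → x = y := fun hxy =>
    Equiv.injective _ (Fin.ext hxy)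
  refine ⟨_, _, isLatinSquare_image A h.left_fst h.right_fst hM eR eC eA,
    isLatinSquare_image B h.left_snd h.right_snd hM eR eC eB, ⟨?_, ?_⟩, ?_, ?_⟩
  · intro i j
    simp only [Finset.mem_image, Finset.mem_univ, true_and, Prod.mk.injEq]
    constructor
    · rintro ⟨_, t, h1, h2, _⟩
      exact ⟨_, t, h1, h2, rfl⟩
    · rintro ⟨_, t, h1, h2, _⟩
      exact ⟨_, t, h1, h2, rfl⟩
  · rintro i j i' j' a b hne h1 h2 ⟨h3, h4⟩
    simp only [Finset.mem_image, Finset.mem_univ, true_and, Prod.mk.injEq] at h1 h2 h3 h4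
    obtain ⟨t₁, rfl, rfl, rfl⟩ := h1
    obtain ⟨t₂, rfl, rfl, ha⟩ := h2
    obtain ⟨t₃, h31, h32, rfl⟩ := h3
    obtain ⟨t₄, h41, h42, hb⟩ := h4
    rw [hi h31, hi h32, hi h41, hi h42] at hb
    obtain ⟨h5, h6⟩ := h.orth _ _ _ _ (hi ha) (hi hb)
    exact hne (by rw [h5, h6])
  · intro k
    simp only [Finset.mem_image, Finset.mem_univ, true_and, Prod.mk.injEq]
    exact ⟨(R k, C k), by rw [heR], by rw [heC], by rw [heA]⟩
  · intro k
    simp only [Finset.mem_image, Finset.mem_univ, true_and, Prod.mk.injEq]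
    exact ⟨(R k, C k), by rw [heR], by rw [heC], by rw [heB]⟩

/-! ### The embedding over finite fields -/

/-- Four families of which any two jointly separate the indices: the cells, with their symbols, of
a pair of orthogonal partial latin squares. -/
structure PairwiseSeparating {ι α : Type*} (r c p q : ι → α) : Prop where
  rc : ∀ k k', r k = r k' → c k = c k' → k = k'
  rp : ∀ k k', r k = r k' → p k = p k' → k = k'
  cp : ∀ k k', c k = c k' → p k = p k' → k = k'
  rq : ∀ k k', r k = r k' → q k = q k' → k = k'
  cq : ∀ k k', c k = c k' → q k = q k' → k = k'
  pq : ∀ k k', p k = p k' → q k = q k' → k = k'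

theorem PairwiseSeparating.comp {ι α β : Type*} {r c p q : ι → α}
    (h : PairwiseSeparating r c p q) {f : α → β} (hf : Function.Injective f) :
    PairwiseSeparating (f ∘ r) (f ∘ c) (f ∘ p) (f ∘ q) :=
  ⟨fun k k' h1 h2 => h.rc k k' (hf h1) (hf h2), fun k k' h1 h2 => h.rp k k' (hf h1) (hf h2),
    fun k k' h1 h2 => h.cp k k' (hf h1) (hf h2), fun k k' h1 h2 => h.rq k k' (hf h1) (hf h2),
    fun k k' h1 h2 => h.cq k k' (hf h1) (hf h2), fun k k' h1 h2 => h.pq k k' (hf h1) (hf h2)⟩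

/-- Embedding over a field with more than two elements, in the fourth power. -/
theorem exists_orthogonalPair_of_field {F ι : Type*} [Field F] [Finite F] [Finite ι]
    {a : F} (ha0 : a ≠ 0) (ha1 : a ≠ 1) {r c p q : ι → F} (h : PairwiseSeparating r c p q) :
    ∃ (A B : ((F × F) × F) × F → ((F × F) × F) × F → ((F × F) × F) × F)
      (R C : ι → ((F × F) × F) × F), IsOrthogonalPair A B ∧
      (∀ k k', R k = R k' ↔ r k = r k') ∧ (∀ k k', C k = C k' ↔ c k = c k') ∧
      (∀ k k', A (R k) (C k) = A (R k') (C k') ↔ p k = p k') ∧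
      (∀ k k', B (R k) (C k) = B (R k') (C k') ↔ q k = q k') := by
  have hZ := isOrthogonalPair_idempotent ha0 ha1
  -- First lift, with the two squares exchanged: the sums `(r k, c k)` are distinct, and the lifted
  -- symbols `A₁` follow `p`. Taking `σ = r` records the row in the `B₁`-symbol.
  obtain ⟨B₁, A₁, h₁, hB₁, hA₁⟩ :=
    (isOrthogonalPair_linear (X := F × F) ha0 ha1).symm.exists_lift hZ (z₀ := 0)
      (by simp) (by simp) (fun k => (r k, 0)) (fun k => (0, c k)) r c r p
      (by
        intro k k' hk
        simp only [Prod.mk_add_mk, add_zero, zero_add, Prod.mk.injEq] at hk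
        exact h.rc k k' hk.1 hk.2)
      h.rc (fun k k' h1 h2 => h.rp k k' h2 h1) (fun k k' h1 h2 => h.cp k k' h2 h1)
      (fun k k' h1 h2 => h.rp k k' h2 h1)
  -- The `B₁`-symbols contain `a * c k` and `r k`, so they separate the cells and can be lifted in
  -- turn to follow `q`.
  obtain ⟨A₂, B₂, h₂, hA₂, hB₂⟩ := h₁.symm.exists_lift hZ (z₀ := 0) (by simp) (by simp)
      (fun k => ((r k, 0), r k)) (fun k => ((0, c k), c k)) r c p q
      (by
        intro k k' hk
        simp only [hB₁, Prod.smul_mk, smul_eq_mul, Prod.mk_add_mk, zero_add, Prod.mk.injEq] at hk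
        exact h.rc k k' hk.2 (mul_left_cancel₀ ha0 hk.1.2))
      h.rc (fun k k' h1 h2 => h.rq k k' h2 h1) (fun k k' h1 h2 => h.cq k k' h2 h1)
      (fun k k' h1 h2 => h.pq k k' h2 h1)
  refine ⟨A₂, B₂, fun k => (((r k, 0), r k), r k), fun k => (((0, c k), c k), c k), h₂,
    by simp, by simp, fun k k' => ?_, hB₂⟩
  -- With `σ = p`, the second lift only appends `p k` to an `A₁`-symbol that already coincides
  -- exactly when `p` does.
  rw [hA₂, hA₂, Prod.mk.injEq, hA₁, and_self]

/-- If the symbols `p` already separate the cells, two factors suffice. -/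
theorem exists_orthogonalPair_of_injective {F ι : Type*} [Field F] [Finite F] [Finite ι]
    {a : F} (ha0 : a ≠ 0) (ha1 : a ≠ 1) {r c p q : ι → F} (h : PairwiseSeparating r c p q)
    (hp : Function.Injective p) (hrc : Function.Injective fun k => r k + a * c k) :
    ∃ (A B : F × F → F × F → F × F)
      (R C : ι → F × F), IsOrthogonalPair A B ∧
      (∀ k k', R k = R k' ↔ r k = r k') ∧ (∀ k k', C k = C k' ↔ c k = c k') ∧
      (∀ k k', A (R k) (C k) = A (R k') (C k') ↔ p k = p k') ∧
      (∀ k k', B (R k) (C k) = B (R k') (C k') ↔ q k = q k') := by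
  obtain ⟨A, B, h₁, hA, hB⟩ :=
    (isOrthogonalPair_linear (X := F) ha0 ha1).exists_lift
      (isOrthogonalPair_idempotent ha0 ha1) (z₀ := 0)
      (by simp) (by simp) r c r c p q hrc
      h.rc (fun k k' h1 h2 => h.rq k k' h2 h1) (fun k k' h1 h2 => h.cq k k' h2 h1)
      (fun k k' h1 h2 => h.pq k k' h2 h1)
  refine ⟨A, B, fun k => (r k, r k), fun k => (c k, c k), h₁, by simp, by simp,
    fun k k' => ?_, hB⟩
  -- The `A`-symbol is `(r k + c k, p k)`; its first entry is harmless only because `p` is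
  -- injective.
  rw [hA, hA, Prod.mk.injEq]
  refine ⟨And.right, fun hk => ?_⟩
  obtain rfl := hp hk
  exact ⟨rfl, rfl⟩

theorem exists_notMem_zero_one_neg_one {F : Type*} [Field F] [Fintype F]
    (hF : 4 ≤ Fintype.card F) : ∃ a : F, a ≠ 0 ∧ a ≠ 1 ∧ a ≠ -1 := by
  classical
  obtain ⟨a, ha⟩ : ∃ a, a ∉ ({0, 1, -1} : Finset F) := by
    by_contra! hall
    have h1 : (Finset.univ : Finset F).card ≤ ({0, 1, -1} : Finset F).card :=
      Finset.card_le_card fun x _ => hall x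
    have h2 : ({0, 1, -1} : Finset F).card ≤ 3 := Finset.card_le_three
    rw [Finset.card_univ] at h1
    omega
  simp only [Finset.mem_insert, Finset.mem_singleton, not_or] at ha
  exact ⟨a, ha⟩

/-- Differences of elements of `{0, 1}` lie in `{0, 1, -1}`, so a nontrivial coincidence would force
`a` to be `0`, `1` or `-1`. -/
theorem eq_and_eq_of_add_mul_eq {F : Type*} [Field F] {a x y x' y' : F} (ha0 : a ≠ 0)
    (ha1 : a ≠ 1) (ha2 : a ≠ -1) (hx : x = 0 ∨ x = 1) (hy : y = 0 ∨ y = 1)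
    (hx' : x' = 0 ∨ x' = 1) (hy' : y' = 0 ∨ y' = 1) (h : x + a * y = x' + a * y') :
    x = x' ∧ y = y' := by
  grind

theorem card_galoisField_two (m : ℕ) (hm : m ≠ 0) [Fintype (GaloisField 2 m)] :
    Fintype.card (GaloisField 2 m) = 2 ^ m := by
  rw [← Nat.card_eq_fintype_card, GaloisField.card 2 m hm]

/-- Numbered form of the embedding; for `m = 1` the symbols `p` must separate the cells. -/
theorem PairwiseSeparating.exists_embedding {ι : Type*} [Finite ι] {n m : ℕ} (hm : 0 < m)
    (hnm : n ≤ 2 ^ m) {r c p q : ι → Fin n} (h : PairwiseSeparating r c p q)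
    (hp : m = 1 → Function.Injective p) :
    ∃ A B : Finset (ℕ × ℕ × ℕ),
      IsLatinSquare (Finset.range (2 ^ (4 * m))) A ∧
      IsLatinSquare (Finset.range (2 ^ (4 * m))) B ∧ AreOrthogonal A B ∧
      (∀ k, ((r k : ℕ), (c k : ℕ), (p k : ℕ)) ∈ A) ∧
      ∀ k, ((r k : ℕ), (c k : ℕ), (q k : ℕ)) ∈ B := by
  have hle : n ≤ 2 ^ (4 * m) := hnm.trans (Nat.pow_le_pow_right (by norm_num) (by omega))
  have hcast := Fin.castLE_injective hle
  rcases (show m = 1 ∨ 2 ≤ m by omega) with rfl | hm2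
  -- The symbols `0, 1` are placed in the field of four elements, and `|F × F| = 16 = 2 ^ (4 * 1)`.
  · let F := GaloisField 2 2
    have : Fintype F := Fintype.ofFinite F
    have hcard : Fintype.card F = 2 ^ 2 := card_galoisField_two 2 (by norm_num)
    obtain ⟨a, ha0, ha1, ha2⟩ := exists_notMem_zero_one_neg_one (F := F) (by omega)
    let f : Fin n → F := fun i => if (i : ℕ) = 0 then 0 else 1
    have hf : Function.Injective f := by
      intro i j hij
      have hi := i.2
      have hj := j.2
      simp only [f] at hij
      apply Fin.ext
      split_ifs at hij with h1 h2 h2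
      · omega
      · exact absurd hij zero_ne_one
      · exact absurd hij one_ne_zero
      · omega
    have hrc : Function.Injective fun k => f (r k) + a * f (c k) := by
      intro k k' hk
      have h01 : ∀ i, f i = 0 ∨ f i = 1 := fun i => by
        simp only [f]; split_ifs <;> simp
      have key := eq_and_eq_of_add_mul_eq ha0 ha1 ha2 (h01 (r k)) (h01 (c k)) (h01 (r k'))
        (h01 (c k')) hk
      exact h.rc k k' (hf key.1) (hf key.2)
    obtain ⟨A, B, R, C, hAB, hR, hC, hA, hB⟩ :=
      exists_orthogonalPair_of_injective ha0 ha1 (h.comp hf) (hf.comp (hp rfl)) hrc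
    refine hAB.exists_embedding (by positivity)
      (by rw [Fintype.card_prod, hcard]; norm_num) R C (Fin.castLE hle ∘ r)
      (Fin.castLE hle ∘ c) (Fin.castLE hle ∘ p) (Fin.castLE hle ∘ q) ?_ ?_ ?_ ?_ <;>
    intro k k'
    · exact (hR k k').trans (hf.eq_iff.trans hcast.eq_iff.symm)
    · exact (hC k k').trans (hf.eq_iff.trans hcast.eq_iff.symm)
    · exact (hA k k').trans (hf.eq_iff.trans hcast.eq_iff.symm)
    · exact (hB k k').trans (hf.eq_iff.trans hcast.eq_iff.symm)
  · let F := GaloisField 2 m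
    have : Fintype F := Fintype.ofFinite F
    have hcard : Fintype.card F = 2 ^ m := card_galoisField_two m (by omega)
    have h4 : 2 ^ 2 ≤ 2 ^ m := Nat.pow_le_pow_right (by norm_num) hm2
    obtain ⟨a, ha0, ha1, -⟩ := exists_notMem_zero_one_neg_one (F := F) (by omega)
    obtain ⟨⟨f, hf⟩⟩ : Nonempty (Fin n ↪ F) :=
      Function.Embedding.nonempty_of_card_le (by rw [Fintype.card_fin, hcard]; exact hnm)
    obtain ⟨A, B, R, C, hAB, hR, hC, hA, hB⟩ :=
      exists_orthogonalPair_of_field ha0 ha1 (h.comp hf)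
    refine hAB.exists_embedding (by positivity)
      (by simp only [Fintype.card_prod, hcard]; ring) R C (Fin.castLE hle ∘ r)
      (Fin.castLE hle ∘ c) (Fin.castLE hle ∘ p) (Fin.castLE hle ∘ q) ?_ ?_ ?_ ?_ <;>
    intro k k'
    · exact (hR k k').trans (hf.eq_iff.trans hcast.eq_iff.symm)
    · exact (hC k k').trans (hf.eq_iff.trans hcast.eq_iff.symm)
    · exact (hA k k').trans (hf.eq_iff.trans hcast.eq_iff.symm)
    · exact (hB k k').trans (hf.eq_iff.trans hcast.eq_iff.symm)

/-! ### Order at most two, and the conclusion -/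

theorem PairwiseSeparating.swap {ι α : Type*} {r c p q : ι → α}
    (h : PairwiseSeparating r c p q) : PairwiseSeparating r c q p :=
  ⟨h.rc, h.rq, h.cq, h.rp, h.cp, fun k k' h1 h2 => h.pq k k' h2 h1⟩

/-- Two cells sharing a `p`-symbol are diagonally opposite in a 2 × 2 square and have different
`q`-symbols. A pair sharing a `q`-symbol is also diagonal and has different `p`-symbols, so one of
its cells has the `p`-symbol of the first pair. The two diagonals then coincide, a contradiction. -/
theorem PairwiseSeparating.injective_or_injective {ι : Type*} {n : ℕ} (hn : n ≤ 2)
    {r c p q : ι → Fin n} (h : PairwiseSeparating r c p q) :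
    Function.Injective p ∨ Function.Injective q := by
  by_contra! hcon
  simp only [Function.Injective, not_forall] at hcon
  obtain ⟨⟨k, k', hpk, hk⟩, j, j', hqj, hj⟩ := hcon
  have two : ∀ x y z : Fin n, x ≠ y → z = x ∨ z = y := by
    intro x y z hxy
    have := x.2
    have := y.2
    have := z.2
    simp only [ne_eq, Fin.ext_iff] at hxy ⊢
    omega
  have hrk : r k ≠ r k' := fun e => hk (h.rp _ _ e hpk)
  have hck : c k ≠ c k' := fun e => hk (h.cp _ _ e hpk)
  have hqk : q k ≠ q k' := fun e => hk (h.pq _ _ hpk e)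
  have hrj : r j ≠ r j' := fun e => hj (h.rq _ _ e hqj)
  have hcj : c j ≠ c j' := fun e => hj (h.cq _ _ e hqj)
  have hpj : p j ≠ p j' := fun e => hj (h.pq _ _ e hqj)
  -- Order the second pair so that its first cell `i` has the `p`-symbol shared by `k` and `k'`.
  have key : ∃ i i', (i = j ∧ i' = j' ∨ i = j' ∧ i' = j) ∧ p i = p k := by
    rcases two _ _ (p k) hpj with e | e
    · exact ⟨j, j', Or.inl ⟨rfl, rfl⟩, e.symm⟩
    · exact ⟨j', j, Or.inr ⟨rfl, rfl⟩, e.symm⟩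
  obtain ⟨i, i', hii, hpi⟩ := key
  have hri : r i ≠ r i' := by rcases hii with ⟨rfl, rfl⟩ | ⟨rfl, rfl⟩; exacts [hrj, hrj.symm]
  have hci : c i ≠ c i' := by rcases hii with ⟨rfl, rfl⟩ | ⟨rfl, rfl⟩; exacts [hcj, hcj.symm]
  have hqi : q i = q i' := by rcases hii with ⟨rfl, rfl⟩ | ⟨rfl, rfl⟩; exacts [hqj, hqj.symm]
  have other : ∀ {x y z w : Fin n}, x ≠ y → x ≠ z → w ≠ x → w = z := by
    intro x y z w h1 h2 h3
    exact (two _ _ w h2).resolve_left h3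
  rcases two _ _ (r i) hrk with e | e
  · obtain rfl := h.rp _ _ e hpi
    obtain rfl := h.rc i' k' (other hri hrk hri.symm) (other hci hck hci.symm)
    exact hqk hqi
  · obtain rfl := h.rp _ _ e (hpi.trans hpk)
    obtain rfl := h.rc i' k (other hri hrk.symm hri.symm) (other hci hck.symm hci.symm)
    exact hqk hqi.symm

theorem AreOrthogonal.symm {α : Type*} {P Q : Finset (α × α × α)} (h : AreOrthogonal P Q) :
    AreOrthogonal Q P :=
  ⟨fun r c => (h.1 r c).symm, fun r₁ c₁ r₂ c₂ x y hne h1 h2 h3 =>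
    h.2 r₁ c₁ r₂ c₂ y x hne h3.1 h3.2 ⟨h1, h2⟩⟩

theorem theorem4p2 (n : ℕ) (P Q : Finset (ℕ × ℕ × ℕ))
    (hP : IsPartialLatinSquare (Finset.range n) P)
    (hQ : IsPartialLatinSquare (Finset.range n) Q)
    (hPQ : AreOrthogonal P Q)
    (m : ℕ) (hm : 0 < m) (hnm : n ≤ 2 ^ m) :
    ∃ A B : Finset (ℕ × ℕ × ℕ),
      IsLatinSquare (Finset.range (2 ^ (4 * m))) A ∧
      IsLatinSquare (Finset.range (2 ^ (4 * m))) B ∧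
      AreOrthogonal A B ∧ P ⊆ A ∧ Q ⊆ B := by
  obtain ⟨-, hPn, hP1, hP2, hP3⟩ := hP
  obtain ⟨-, hQn, hQ1, hQ2, hQ3⟩ := hQ
  obtain ⟨hcell, horth⟩ := hPQ
  simp only [Finset.mem_range] at hPn hQn
  have hex : ∀ k : P, ∃ y, (k.1.1, k.1.2.1, y) ∈ Q := fun k => (hcell _ _).1 ⟨k.1.2.2, k.2⟩
  choose q hq using hex
  let r : P → Fin n := fun k => ⟨k.1.1, (hPn _ _ _ k.2).1⟩
  let c : P → Fin n := fun k => ⟨k.1.2.1, (hPn _ _ _ k.2).2.1⟩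
  let p : P → Fin n := fun k => ⟨k.1.2.2, (hPn _ _ _ k.2).2.2⟩
  let q' : P → Fin n := fun k => ⟨q k, (hQn _ _ _ (hq k)).2.2⟩
  have hrc : ∀ k k', r k = r k' → c k = c k' → k = k' := by
    rintro ⟨⟨a, b, x⟩, h1⟩ ⟨⟨a', b', x'⟩, h2⟩ hr hc
    simp only [r, c, Fin.mk.injEq] at hr hc
    subst hr hc
    obtain rfl := hP1 _ _ _ _ h1 h2
    rfl
  have hsep : PairwiseSeparating r c p q' := by
    refine ⟨hrc, fun k k' h1 h2 => hrc k k' h1 ?_, fun k k' h1 h2 => hrc k k' ?_ h1,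
      fun k k' h1 h2 => hrc k k' h1 ?_, fun k k' h1 h2 => hrc k k' ?_ h1, fun k k' h1 h2 => ?_⟩ <;>
    have e1 := congrArg Fin.val h1 <;> have e2 := congrArg Fin.val h2 <;>
    simp only [r, c, p, q'] at e1 e2
    · refine Fin.ext (hP2 k.1.1 _ _ k.1.2.2 k.2 ?_)
      rw [e1, e2]; exact k'.2
    · refine Fin.ext (hP3 _ _ k.1.2.1 k.1.2.2 k.2 ?_)
      rw [e1, e2]; exact k'.2
    · refine Fin.ext (hQ2 k.1.1 _ _ (q k) (hq k) ?_)
      rw [e1, e2]; exact hq k'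
    · refine Fin.ext (hQ3 _ _ k.1.2.1 (q k) (hq k) ?_)
      rw [e1, e2]; exact hq k'
    · by_contra hne
      refine horth k.1.1 k.1.2.1 k'.1.1 k'.1.2.1 k.1.2.2 (q k) (fun e => hne ?_) k.2 ?_
        ⟨hq k, ?_⟩
      · rw [Prod.mk.injEq] at e
        exact hrc k k' (Fin.ext e.1) (Fin.ext e.2)
      · rw [e1]; exact k'.2
      · rw [e2]; exact hq k'
  have main : ∃ A B : Finset (ℕ × ℕ × ℕ),
      IsLatinSquare (Finset.range (2 ^ (4 * m))) A ∧
      IsLatinSquare (Finset.range (2 ^ (4 * m))) B ∧ AreOrthogonal A B ∧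
      (∀ k, ((r k : ℕ), (c k : ℕ), (p k : ℕ)) ∈ A) ∧
      ∀ k, ((r k : ℕ), (c k : ℕ), (q' k : ℕ)) ∈ B := by
    by_cases hinj : m = 1 → Function.Injective p
    · exact hsep.exists_embedding hm hnm hinj
    -- Here `m = 1` and `p` is not injective, so `q'` is; exchange the roles of the two squares.
    · rw [Classical.not_imp] at hinj
      obtain ⟨hm1, hinj⟩ := hinj
      have hn2 : n ≤ 2 := by simpa [hm1] using hnm
      obtain ⟨B, A, hB, hA, hBA, hq'B, hpA⟩ := hsep.swap.exists_embedding hm hnm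
        fun _ => (hsep.injective_or_injective hn2).resolve_left hinj
      exact ⟨A, B, hA, hB, hBA.symm, hpA, hq'B⟩
  obtain ⟨A, B, hA, hB, hAB, hPA, hQB⟩ := main
  refine ⟨A, B, hA, hB, hAB, fun t ht => hPA ⟨t, ht⟩, ?_⟩
  rintro ⟨a, b, y⟩ ht
  obtain ⟨x, hx⟩ := (hcell a b).2 ⟨y, ht⟩
  have := hQB ⟨(a, b, x), hx⟩
  -- The symbol chosen by `q` in this cell is the given `y`, since a cell of `Q` holds only one
  -- symbol.
  obtain rfl := hQ1 _ _ _ _ ht (hq ⟨(a, b, x), hx⟩)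
  exact this
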